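/- For a group $G$ let $I(G')=\{x\in G : x^k\in G' \text{ for some } k\ge 1\}$ be the isolator of its commutator subgroup $G'$. Let $\mathcal N_2(n,t)$ be the class of finitely generated torsion-free 2-step nilpotent groups $G$ (i.e. $G'$ is central) with $\operatorname{rank} G'=t$ and $\operatorname{rank} G/I(G')=n$. For $G\in\mathcal N_2(n,t)$ the groups $I(G')$ and $G/I(G')$ are free abelian; a choice of a basis $b_1,\dots,b_t$ of $I(G')$ and of a basis $a_1,\dots,a_n$ of $G$ modulo $I(G')$ determines a $t$-tuple $\Phi=(\varphi_1,\dots,\varphi_t)$ of alternating integer bilinear forms on $\mathbb Z^n$ by $$[a_i,a_j]=b_1^{\varphi_1(e_i,e_j)}\cdots b_t^{\varphi_t(e_i,e_j)}\qquad(1\le i,j\le n),$$ where $e_1,\dots,e_n$ is the standard basis of $\mathbb Z^n$, and we say that $\Phi$ corresponds to $G$. Let $B_n(K)$ be the space of alternating bilinear forms on $K^n$, identified with their matrices, so that $B_n(\mathbb Z)\subset B_n(\mathbb Q)$, and let $P_{n,t}\subset B_n(\mathbb Z)^t$ be the set of linearly independent $t$-tuples. A generic group in $\mathcal N_2(n,t)$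 is said to have a property $\mathcal A$ if the set of those points of $P_{n,t}$ that correspond to some group of $\mathcal N_2(n,t)$ without the property $\mathcal A$ is contained in a proper Zariski-closed subset of the affine space $B_n(\mathbb Q)^t$. The polycyclic rank (Hirsch length) of a polycyclic group is the number of infinite factors in a subnormal series with cyclic factors. Corollary. Let $n,t,N$ be non-negative integers with $N<n$ and $$t<\frac{n^2}{2}-n\left(N-\frac12\right)+\frac{N(N-1)}{2}+1 .$$ Then a generic group in $\mathcal N_2(n,t)$ admits no surjective homomorphism onto a non-abelian torsion-free group of polycyclic rank $N$. -/

import Mathlib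

namespace GenericNilpotent

/-- A group is torsion-free if its only element of finite order is the identity. -/
def TorsionFree (G : Type*) [Group G] : Prop := ∀ g : G, IsOfFinOrder g → g = 1

/-- The isolator `I(G') = {x | x ^ k ∈ G' for some k ≥ 1}` of the commutator subgroup. -/
def isolator (G : Type*) [Group G] : Subgroup G where
  carrier := {x | ∃ k : ℕ, 0 < k ∧ x ^ k ∈ commutator G}
  one_mem' := ⟨1, one_pos, by simp⟩
  mul_mem' := by
    rintro x y ⟨k, hk, hx⟩ ⟨m, hm, hy⟩
    refine ⟨k * m, Nat.mul_pos hk hm, ?_⟩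
    rw [← Abelianization.ker_of, MonoidHom.mem_ker] at *
    rw [map_pow] at *
    rw [map_mul, mul_pow, pow_mul, hx, one_pow, mul_comm k m, pow_mul, hy, one_pow, one_mul]
  inv_mem' := by
    rintro x ⟨k, hk, hx⟩
    exact ⟨k, hk, by rw [inv_pow]; exact inv_mem hx⟩

theorem commutator_le_isolator (G : Type*) [Group G] : commutator G ≤ isolator G :=
  fun x hx => ⟨1, one_pos, by simpa using hx⟩

instance isolator_normal (G : Type*) [Group G] : (isolator G).Normal :=
  Subgroup.Normal.of_commutator_le G (commutator_le_isolator G)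

/-- The rank of a commutative group `A`: its rank as a `ℤ`-module. -/
noncomputable def commRank (A : Type*) [Group A] (h : ∀ x y : A, x * y = y * x) : ℕ :=
  letI : CommGroup A := { ‹Group A› with mul_comm := h }
  Module.finrank ℤ (Additive A)

theorem commutator_comm {G : Type*} [Group G] (h : commutator G ≤ Subgroup.center G)
    (x y : commutator G) : x * y = y * x :=
  Subtype.ext ((Subgroup.mem_center_iff.1 (h y.2)) x)

theorem quotient_isolator_comm (G : Type*) [Group G] (x y : G ⧸ isolator G) : x * y = y * x := by
  induction x using QuotientGroup.induction_on with | H a => ?_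
  induction y using QuotientGroup.induction_on with | H b => ?_
  rw [← QuotientGroup.mk_mul, ← QuotientGroup.mk_mul, QuotientGroup.eq]
  apply commutator_le_isolator
  rw [← Abelianization.ker_of, MonoidHom.mem_ker]
  rw [map_mul, map_inv, map_mul, map_mul, mul_comm (Abelianization.of b), inv_mul_cancel]

/-- The class `𝒩₂(n, t)`: finitely generated torsion-free 2-step nilpotent groups `G` with
`rank G' = t` and `rank G / I(G') = n`. -/
structure IsN2 (n t : ℕ) (G : Type*) [Group G] : Prop where
  fg : Group.FG G
  torsionFree : TorsionFree G
  two_step : commutator G ≤ Subgroup.center G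
  rank_commutator : commRank (commutator G) (commutator_comm two_step) = t
  rank_quotient : commRank (G ⧸ isolator G) (quotient_isolator_comm G) = n

/-- The `R`-module `B_n(R)` of alternating bilinear forms on `R ^ n`. -/
def AltForms (R : Type*) [CommRing R] (n : ℕ) :
    Submodule R (LinearMap.BilinForm R (Fin n → R)) where
  carrier := {φ | φ.IsAlt}
  add_mem' := fun ha hb => ha.add hb
  zero_mem' := LinearMap.BilinForm.isAlt_zero
  smul_mem' := fun c _ ha => ha.smul c

/-- The entry `φ (e_i, e_j)` of the matrix of `φ` in the standard basis of `R ^ n`. -/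
def coeff {R : Type*} [CommRing R] {n : ℕ} (φ : AltForms R n) (i j : Fin n) : R :=
  φ.1 (Pi.single i 1) (Pi.single j 1)

/-- The rational alternating form having the same matrix as a given integer one. -/
noncomputable def toRat {n : ℕ} (φ : AltForms ℤ n) : AltForms ℚ n :=
  ⟨Matrix.toBilin' (Matrix.of fun i j => ((coeff φ i j : ℤ) : ℚ)), by
    change LinearMap.IsAlt _
    rw [LinearMap.isAlt_iff_eq_neg_flip]
    refine (Matrix.toBilin' (R₁ := ℚ) (n := Fin n)).symm.injective ?_
    ext i j
    have h := φ.2.neg_eq (Pi.single j 1) (Pi.single i 1)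
    simp only [LinearMap.BilinForm.toMatrix'_apply, Matrix.toBilin'_symm, LinearMap.neg_apply,
      LinearMap.flip_apply, Matrix.toBilin'_single, Matrix.of_apply, coeff]
    rw [← h]
    push_cast
    rfl⟩

/-- The set `P_{n,t}` of linearly independent `t`-tuples of integer alternating forms. -/
def P (n t : ℕ) : Set (Fin t → AltForms ℤ n) := {Φ | LinearIndependent ℤ Φ}

/-- The ordered product `x_1 ^ k_1 ⋯ x_m ^ k_m`. -/
def monomial {G : Type*} [Group G] {m : ℕ} (x : Fin m → G) (k : Fin m → ℤ) : G :=
  (List.ofFn fun i => x i ^ k i).prod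

/-- `Φ` is the tuple of forms of `G` with respect to some basis `b` of `S = I(G')` and some
basis `a` of `G` modulo `S`, i.e. the commutator map of `G` is
`[a_i, a_j] = b_1 ^ φ_1(a_i, a_j) ⋯ b_t ^ φ_t(a_i, a_j)`. -/
def Corresponds {n t : ℕ} (Φ : Fin t → AltForms ℤ n) (G : Type*) [Group G] : Prop :=
  ∃ (a : Fin n → G) (b : Fin t → G),
    (∀ g : G, ∃! k : Fin n → ℤ, (monomial a k)⁻¹ * g ∈ isolator G) ∧
    (∀ l, b l ∈ isolator G) ∧
    (∀ s ∈ isolator G, ∃! q : Fin t → ℤ, monomial b q = s) ∧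
    ∀ i j, a i * a j * (a i)⁻¹ * (a j)⁻¹ = monomial b fun l => coeff (Φ l) i j

/-- Zariski-closed subsets of the affine space `B_n(ℚ) ^ t`: common zero sets of polynomials
in the matrix entries of the forms. -/
def IsZariskiClosed {n t : ℕ} (Z : Set (Fin t → AltForms ℚ n)) : Prop :=
  ∃ F : Set (MvPolynomial (Fin t × Fin n × Fin n) ℚ),
    Z = {Ψ | ∀ f ∈ F, MvPolynomial.eval (fun p => coeff (Ψ p.1) p.2.1 p.2.2) f = 0}

/-- A generic group of `𝒩₂(n, t)` has the property `A`: the set of the points of `P_{n,t}`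
corresponding to the groups of `𝒩₂(n, t)` without the property `A` is contained in a proper
Zariski-closed subset of `B_n(ℚ) ^ t`. -/
def Generically.{u} (n t : ℕ) (A : ∀ (G : Type u) [Group G], Prop) : Prop :=
  ∃ Z : Set (Fin t → AltForms ℚ n), IsZariskiClosed Z ∧ Z ≠ Set.univ ∧
    ∀ Φ ∈ P n t, (∃ (G : Type u) (_ : Group G), IsN2 n t G ∧ Corresponds Φ G ∧ ¬ A G) →
      (fun l => toRat (Φ l)) ∈ Z

/-- `H` is a polycyclic group of polycyclic rank (Hirsch length) `N`: it has a subnormal series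
with cyclic factors, exactly `N` of which are infinite. -/
def HasPolycyclicRank (H : Type*) [Group H] (N : ℕ) : Prop :=
  ∃ (m : ℕ) (K : Fin (m + 1) → Subgroup H),
    K 0 = ⊥ ∧ K (Fin.last m) = ⊤ ∧
    (∀ i : Fin m, K i.castSucc ≤ K i.succ ∧
      ∃ _ : ((K i.castSucc).subgroupOf (K i.succ)).Normal,
        IsCyclic (K i.succ ⧸ (K i.castSucc).subgroupOf (K i.succ))) ∧
    Nat.card {i : Fin m // Infinite (K i.succ ⧸ (K i.castSucc).subgroupOf (K i.succ))} = N

end GenericNilpotent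

open Module

namespace GenericNilpotent

/-! Let `f` map `G` onto such an `H`. Then `H` has class two, and a nontrivial commutator of `H` has
infinite order, so some `l` from the center of `H` to ℚ is nonzero on it. Composing `l` with `f` on
I(G') gives coefficients `c ≠ 0`, and row `i` of Σ c_k φ_k lists the values l([f a_i, f a_j]). The
homomorphism u ↦ (l([u, f a_j]))_j kills the center, where `l` already uses up one unit of
polycyclic rank. Hence Σ c_k φ_k has rank less than `N` (`exists_rank_lt_of_surjective`).

It remains to count dimensions. A skew matrix of rank at most r = N - 1 depends on C(n,2) - C(n-r,2)
parameters. A tuple with such a combination is given by this matrix, the other t - 1 forms and t - 1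
coefficients. This is fewer than t·C(n,2) parameters exactly when t ≤ C(n-r,2), which is the
hypothesis. So a nonzero polynomial vanishes on these tuples (`exists_polynomial_of_rank_le`). -/

/-! ### Commutators and isolators in class two. -/

theorem TorsionFree.eq_one_of_pow_eq_one {H : Type*} [Group H] (h : TorsionFree H) {x : H} {k : ℕ}
    (hk : 0 < k) (hx : x ^ k = 1) : x = 1 :=
  h x (isOfFinOrder_iff_pow_eq_one.2 ⟨k, hk, hx⟩)

open scoped commutatorElement in
/-- In a group of class at most two, `x ↦ [x, y]` is a homomorphism to the center. -/
def commutatorHom {H : Type*} [Group H] (h : commutator H ≤ Subgroup.center H) (y : H) :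
    H →* Subgroup.center H where
  toFun x := ⟨⁅x, y⁆, h (Subgroup.commutator_mem_commutator (Subgroup.mem_top x)
    (Subgroup.mem_top y))⟩
  map_one' := by simp
  map_mul' x₁ x₂ := by
    have hc : ⁅x₂, y⁆ ∈ Subgroup.center H :=
      h (Subgroup.commutator_mem_commutator (Subgroup.mem_top x₂) (Subgroup.mem_top y))
    refine Subtype.ext ?_
    change ⁅x₁ * x₂, y⁆ = ⁅x₁, y⁆ * ⁅x₂, y⁆
    rw [show ⁅x₁ * x₂, y⁆ = x₁ * ⁅x₂, y⁆ * x₁⁻¹ * ⁅x₁, y⁆ by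
        simp only [commutatorElement_def]; group,
      Subgroup.mem_center_iff.1 hc x₁, mul_inv_cancel_right, Subgroup.mem_center_iff.1 hc]

theorem coe_commutatorHom {H : Type*} [Group H] (h : commutator H ≤ Subgroup.center H)
    (x y : H) : (commutatorHom h y x : H) = x * y * x⁻¹ * y⁻¹ := rfl

theorem commutatorHom_eq_one_of_mem_center {H : Type*} [Group H]
    (h : commutator H ≤ Subgroup.center H) {x : H} (hx : x ∈ Subgroup.center H) (y : H) :
    commutatorHom h y x = 1 := by
  refine Subtype.ext ?_
  rw [coe_commutatorHom, ← Subgroup.mem_center_iff.1 hx y]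
  simp

/-- If x^k is central then [x, y]^k = [x^k, y] = 1, and torsion-freeness gives [x, y] = 1. -/
theorem isolator_le_center {H : Type*} [Group H] (htf : TorsionFree H)
    (h : commutator H ≤ Subgroup.center H) : isolator H ≤ Subgroup.center H := by
  rintro x ⟨k, hk, hx⟩
  refine Subgroup.mem_center_iff.2 fun y => ?_
  have h1 : commutatorHom h y x ^ k = 1 := by
    rw [← map_pow, commutatorHom_eq_one_of_mem_center h (h hx)]
  have h2 : (commutatorHom h y x : H) = 1 :=
    htf.eq_one_of_pow_eq_one hk (by rw [← Subgroup.coe_pow, h1, Subgroup.coe_one])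
  rw [coe_commutatorHom] at h2
  exact (mul_inv_eq_iff_eq_mul.1 (mul_inv_eq_one.1 h2)).symm

theorem map_commutator_le {G H : Type*} [Group G] [Group H] (f : G →* H) {x : G}
    (hx : x ∈ commutator G) : f x ∈ commutator H := by
  have : commutator G ≤ (commutator H).comap f := by
    rw [← Subgroup.map_le_iff_le_comap, commutator_def, Subgroup.map_commutator]
    exact Subgroup.commutator_mono le_top le_top
  exact this hx

theorem map_mem_isolator {G H : Type*} [Group G] [Group H] (f : G →* H) {x : G}
    (hx : x ∈ isolator G) : f x ∈ isolator H := by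
  obtain ⟨k, hk, hx⟩ := hx
  exact ⟨k, hk, by rw [← map_pow]; exact map_commutator_le f hx⟩

theorem commutator_le_center_of_surjective {G H : Type*} [Group G] [Group H] {f : G →* H}
    (hf : Function.Surjective f) (h : commutator G ≤ Subgroup.center G) :
    commutator H ≤ Subgroup.center H := by
  rw [commutator_def, ← Subgroup.map_top_of_surjective f hf, ← Subgroup.map_commutator]
  rintro _ ⟨x, hx, rfl⟩
  refine Subgroup.mem_center_iff.2 fun y => ?_
  obtain ⟨y, rfl⟩ := hf y
  rw [← map_mul, ← map_mul, Subgroup.mem_center_iff.1 (h hx) y]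

/-- Every element of infinite order of an abelian group is detected by a homomorphism to `ℚ`. -/
theorem exists_hom_rat_eq_one {A : Type*} [Group A] [IsMulCommutative A] (z : A)
    (hz : ∀ k : ℤ, z ^ k = 1 → k = 0) : ∃ l : A →* Multiplicative ℚ, (l z).toAdd = 1 := by
  let : CommGroup A := { ‹Group A› with mul_comm := mul_comm' }
  have hinj : Function.Injective (zmultiplesHom (Additive A) (Additive.ofMul z)) := by
    rw [injective_iff_map_eq_zero]
    exact fun k hk => hz k (by simpa [← ofMul_zpow] using hk)
  obtain ⟨l, hl⟩ := (Module.Baer.of_divisible ℚ).extension_property_addMonoidHom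
    (zmultiplesHom (Additive A) (Additive.ofMul z)) hinj (Int.castAddHom ℚ)
  refine ⟨AddMonoidHom.toMultiplicativeRight l, ?_⟩
  have := DFunLike.congr_fun hl 1
  simpa using this

/-! ### Rational ranks along a polycyclic series. -/

/-- The `ℚ`-span of the image of a set under a homomorphism to a rational vector space. -/
def ratSpan {H V : Type*} [Group H] [AddCommGroup V] [Module ℚ V] (μ : H →* Multiplicative V)
    (K : Set H) : Submodule ℚ V :=
  Submodule.span ℚ ((fun x => (μ x).toAdd) '' K)

section ratSpan

variable {H V : Type*} [Group H] [AddCommGroup V] [Module ℚ V] (μ : H →* Multiplicative V)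

theorem toAdd_mem_ratSpan {K : Set H} {x : H} (hx : x ∈ K) : (μ x).toAdd ∈ ratSpan μ K :=
  Submodule.subset_span ⟨x, hx, rfl⟩

theorem ratSpan_mono {K K' : Set H} (h : K ⊆ K') : ratSpan μ K ≤ ratSpan μ K' :=
  Submodule.span_mono (Set.image_mono h)

theorem ratSpan_le_of_pow_mem {K K' : Set H} {e : ℕ} (he : 0 < e)
    (h : ∀ x ∈ K', x ^ e ∈ K) : ratSpan μ K' ≤ ratSpan μ K := by
  refine Submodule.span_le.2 ?_
  rintro _ ⟨x, hx, rfl⟩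
  have h1 := toAdd_mem_ratSpan μ (h x hx)
  rw [map_pow, toAdd_pow, ← Nat.cast_smul_eq_nsmul ℚ] at h1
  exact (Submodule.smul_mem_iff _ (Nat.cast_ne_zero.2 he.ne')).1 h1

theorem ratSpan_le_sup_of_zpow_mul_mem {K K' : Set H} {g : H}
    (h : ∀ x ∈ K', ∃ k : ℤ, (g ^ k)⁻¹ * x ∈ K) :
    ratSpan μ K' ≤ ratSpan μ K ⊔ Submodule.span ℚ {(μ g).toAdd} := by
  refine Submodule.span_le.2 ?_
  rintro _ ⟨x, hx, rfl⟩
  obtain ⟨k, hk⟩ := h x hx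
  have h1 : (μ x).toAdd = (μ ((g ^ k)⁻¹ * x)).toAdd + (k : ℚ) • (μ g).toAdd := by
    rw [map_mul, map_inv, map_zpow, toAdd_mul, toAdd_inv, toAdd_zpow, Int.cast_smul_eq_zsmul]
    abel
  change (μ x).toAdd ∈ _
  rw [h1]
  exact Submodule.add_mem_sup (toAdd_mem_ratSpan μ hk)
    (Submodule.smul_mem _ _ (Submodule.mem_span_singleton_self _))

variable [FiniteDimensional ℚ V] {C : Subgroup H} (l : C →* Multiplicative ℚ)

theorem finrank_ratSpan_le_one (K : Set C) : finrank ℚ (ratSpan l K) ≤ 1 :=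
  (Submodule.finrank_le _).trans_eq (finrank_self ℚ)

/-- A cyclic extension raises the sum of the two ranks by at most one. -/
theorem finrank_ratSpan_add_le_of_cyclic (hμ : ∀ x ∈ C, μ x = 1) {K K' : Subgroup H} {g : H}
    (h : ∀ x ∈ K', ∃ k : ℤ, (g ^ k)⁻¹ * x ∈ K) :
    finrank ℚ (ratSpan μ (K' : Set H)) + finrank ℚ (ratSpan l {x : C | (x : H) ∈ K'}) ≤
      finrank ℚ (ratSpan μ (K : Set H)) + finrank ℚ (ratSpan l {x : C | (x : H) ∈ K}) + 1 := by
  have hsup := ratSpan_le_sup_of_zpow_mul_mem μ (K := (K : Set H)) (K' := (K' : Set H)) h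
  -- Either `g` adds nothing to the span of `μ`, and the `l`-rank is at most one anyway; or the
  -- `μ`-rank grows by at most one and `C` acquires no new elements.
  by_cases hg : (μ g).toAdd ∈ ratSpan μ (K : Set H)
  · have h1 : ratSpan μ (K' : Set H) ≤ ratSpan μ (K : Set H) :=
      hsup.trans (sup_le le_rfl ((Submodule.span_singleton_le_iff_mem _ _).2 hg))
    have h2 := Submodule.finrank_mono h1
    have h3 := finrank_ratSpan_le_one l {x : C | (x : H) ∈ K'}
    omega
  · have h1 : ratSpan l {x : C | (x : H) ∈ K'} ≤ ratSpan l {x : C | (x : H) ∈ K} := by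
      refine ratSpan_mono l fun x hx => ?_
      obtain ⟨k, hk⟩ := h x hx
      have hm := toAdd_mem_ratSpan μ (K := (K : Set H)) hk
      rw [map_mul, hμ x x.2, mul_one, map_inv, map_zpow, toAdd_inv, toAdd_zpow,
        Submodule.neg_mem_iff, ← Int.cast_smul_eq_zsmul ℚ] at hm
      -- Since `μ x = 0`, the multiple `k • μ g` lies in the old span, while `μ g` does not.
      have hk0 : k = 0 := by
        by_contra hne
        exact hg ((Submodule.smul_mem_iff _ (Int.cast_ne_zero.2 hne)).1 hm)
      simpa [hk0] using hk
    have h2 := Submodule.finrank_mono h1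
    have h3 := Submodule.finrank_mono hsup
    have h4 := Submodule.finrank_add_le_finrank_add_finrank (ratSpan μ (K : Set H))
      (Submodule.span ℚ {(μ g).toAdd})
    have h5 := finrank_span_le_card (R := ℚ) ({(μ g).toAdd} : Set V)
    simp only [Set.toFinset_singleton, Finset.card_singleton] at h5
    omega

/-- Finite factors leave the ranks unchanged, because `e` is invertible in ℚ. -/
theorem finrank_ratSpan_add_le_of_pow_mem {K K' : Subgroup H} {e : ℕ} (he : 0 < e)
    (h : ∀ x ∈ K', x ^ e ∈ K) :
    finrank ℚ (ratSpan μ (K' : Set H)) + finrank ℚ (ratSpan l {x : C | (x : H) ∈ K'}) ≤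
      finrank ℚ (ratSpan μ (K : Set H)) + finrank ℚ (ratSpan l {x : C | (x : H) ∈ K}) :=
  add_le_add (Submodule.finrank_mono (ratSpan_le_of_pow_mem μ he h))
    (Submodule.finrank_mono (ratSpan_le_of_pow_mem l he fun x hx => by simpa using h x hx))

theorem le_card_of_step_le {m : ℕ} (a : Fin (m + 1) → ℕ) (p : Fin m → Prop) (h0 : a 0 = 0)
    (h1 : ∀ i : Fin m, a i.succ ≤ a i.castSucc + 1) (h2 : ∀ i : Fin m, ¬ p i → a i.succ ≤ a i.castSucc) :
    a (Fin.last m) ≤ Nat.card {i // p i} := by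
  classical
  have key : ∀ (m : ℕ) (a : Fin (m + 1) → ℕ) (q : Fin m → ℕ),
      (∀ i : Fin m, a i.succ ≤ a i.castSucc + q i) → a (Fin.last m) ≤ a 0 + ∑ i, q i := by
    intro m
    induction m with
    | zero => intro a q _; simp
    | succ m ih =>
      intro a q h
      rw [Fin.sum_univ_castSucc]
      have := ih (fun i => a i.castSucc) (fun i => q i.castSucc) fun i => h i.castSucc
      have h' := h (Fin.last m)
      change a (Fin.last (m + 1)) ≤ _ at h'
      rw [Fin.castSucc_zero] at this
      omega
  have := key m a (fun i => if p i then 1 else 0) fun i => by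
    by_cases hp : p i
    · simpa [hp] using h1 i
    · simpa [hp] using h2 i hp
  rw [h0, zero_add] at this
  refine this.trans_eq ?_
  rw [Nat.card_eq_fintype_card, Fintype.card_subtype, Finset.sum_boole]
  simp

/-- The rank of a homomorphism that kills a subgroup of positive rank is less than the
polycyclic rank. -/
theorem finrank_ratSpan_lt_of_hasPolycyclicRank {N : ℕ} (hH : HasPolycyclicRank H N)
    (hμ : ∀ x ∈ C, μ x = 1) {z : C} (hz : l z ≠ 1) :
    finrank ℚ (ratSpan μ (Set.univ : Set H)) < N := by
  obtain ⟨m, K, h0, htop, hstep, rfl⟩ := hH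
  have key := le_card_of_step_le
    (fun i => finrank ℚ (ratSpan μ (K i : Set H)) + finrank ℚ (ratSpan l {x : C | (x : H) ∈ K i}))
    (fun i : Fin m => Infinite (K i.succ ⧸ (K i.castSucc).subgroupOf (K i.succ)))
    ?_ ?_ ?_
  -- The nonzero `l` contributes at least one to the sum, which makes the inequality for `μ` strict.
  · have hl : ratSpan l (Set.univ : Set C) ≠ ⊥ := by
      refine (Submodule.ne_bot_iff _).2 ⟨(l z).toAdd, toAdd_mem_ratSpan l (Set.mem_univ z), ?_⟩
      exact fun h => hz (Multiplicative.toAdd.injective h)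
    have hpos := Submodule.one_le_finrank_iff.2 hl
    have h1 : ratSpan μ (K (Fin.last m) : Set H) = ratSpan μ Set.univ := by
      rw [htop, Subgroup.coe_top]
    have h2 : ratSpan l {x : C | (x : H) ∈ K (Fin.last m)} = ratSpan l Set.univ := by
      congr 1
      ext x
      simp [htop]
    beta_reduce at key
    rw [h1, h2] at key
    omega
  · have h1 : ratSpan μ (K 0 : Set H) = ⊥ := by
      simp [ratSpan, h0]
    have h2 : ratSpan l {x : C | (x : H) ∈ K 0} = ⊥ := by
      simp [ratSpan, h0, Subgroup.mem_bot]
    rw [h1, h2, finrank_bot, finrank_bot]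
  · intro i
    obtain ⟨hle, hn, hcyc⟩ := hstep i
    obtain ⟨g, hg⟩ := hcyc.exists_generator
    induction g using QuotientGroup.induction_on with | H g => ?_
    refine finrank_ratSpan_add_le_of_cyclic μ l hμ (g := (g : H)) fun x hx => ?_
    obtain ⟨k, hk⟩ := Subgroup.mem_zpowers_iff.1 (hg ((⟨x, hx⟩ : K i.succ) : _ ⧸ _))
    rw [← QuotientGroup.mk_zpow, QuotientGroup.eq, Subgroup.mem_subgroupOf] at hk
    exact ⟨k, by simpa using hk⟩
  · intro i hi
    obtain ⟨hle, hn, hcyc⟩ := hstep i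
    rw [not_infinite_iff_finite] at hi
    refine finrank_ratSpan_add_le_of_pow_mem μ l (Nat.card_pos
      (α := K i.succ ⧸ (K i.castSucc).subgroupOf (K i.succ))) fun x hx => ?_
    have := pow_card_eq_one' (x := ((⟨x, hx⟩ : K i.succ) :
      K i.succ ⧸ (K i.castSucc).subgroupOf (K i.succ)))
    rw [← QuotientGroup.mk_pow, QuotientGroup.eq_one_iff, Subgroup.mem_subgroupOf] at this
    simpa using this

end ratSpan

/-! ### From a quotient to a combination of low rank. -/

theorem map_monomial {G H : Type*} [Group G] [Group H] (f : G →* H) {m : ℕ} (x : Fin m → G)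
    (k : Fin m → ℤ) : f (monomial x k) = monomial (fun i => f (x i)) k := by
  simp [monomial, map_list_prod, List.map_ofFn, Function.comp_def]

theorem toAdd_monomial {V : Type*} [AddCommGroup V] {m : ℕ} (x : Fin m → Multiplicative V)
    (k : Fin m → ℤ) : (monomial x k).toAdd = ∑ i, k i • (x i).toAdd := by
  simp [monomial, List.prod_ofFn, toAdd_prod]

/-- A non-abelian torsion-free quotient of polycyclic rank `N` makes some nontrivial rational
combination of the forms have rank less than `N`. -/
theorem exists_rank_lt_of_surjective {n t N : ℕ} {Φ : Fin t → AltForms ℤ n}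
    {G H : Type*} [Group G] [Group H] (hG : commutator G ≤ Subgroup.center G)
    (hΦ : Corresponds Φ G) (htf : TorsionFree H) (hna : ∃ x y : H, x * y ≠ y * x)
    (hH : HasPolycyclicRank H N) {f : G →* H} (hf : Function.Surjective f) :
    ∃ c : Fin t → ℚ, c ≠ 0 ∧
      (Matrix.of fun i j => ∑ l, c l * ((coeff (Φ l) i j : ℤ) : ℚ)).rank < N := by
  obtain ⟨a, b, -, hb, hbu, hab⟩ := hΦ
  have hc := commutator_le_center_of_surjective hf hG
  obtain ⟨x, y, hxy⟩ := hna
  have hz1 : (commutatorHom hc y x : H) ≠ 1 := fun h => hxy <| by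
    rw [coe_commutatorHom] at h
    exact mul_inv_eq_iff_eq_mul.1 (mul_inv_eq_one.1 h)
  obtain ⟨l, hlz⟩ := exists_hom_rat_eq_one (commutatorHom hc y x) fun k hk => by
    by_contra hne
    have hk' : (commutatorHom hc y x : H) ^ k.natAbs = 1 := by
      rw [← Subgroup.coe_pow, pow_natAbs_eq_one.2 hk, Subgroup.coe_one]
    exact hz1 (htf.eq_one_of_pow_eq_one (Int.natAbs_pos.2 hne) hk')
  have hiso : ∀ s ∈ isolator G, f s ∈ Subgroup.center H := fun s hs =>
    isolator_le_center htf hc (map_mem_isolator f hs)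
  let F : isolator G →* Subgroup.center H :=
    (f.comp (isolator G).subtype).codRestrict _ fun s => hiso s s.2
  let b' : Fin t → isolator G := fun k => ⟨b k, hb k⟩
  have hval : ∀ (s : isolator G) (q : Fin t → ℤ), monomial b q = s →
      (l (F s)).toAdd = ∑ k, (q k : ℚ) * (l (F (b' k))).toAdd := by
    intro s q hq
    have hs : s = monomial b' q := by
      refine Subtype.ext ?_
      rw [← hq]
      exact (map_monomial (isolator G).subtype b' q).symm
    rw [hs, map_monomial, map_monomial, toAdd_monomial]
    simp
  have hcomm : ∀ g h : G, ∀ hgh : g * h * g⁻¹ * h⁻¹ ∈ isolator G,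
      F ⟨_, hgh⟩ = commutatorHom hc (f h) (f g) := fun g h hgh => by
    refine Subtype.ext ?_
    change f (g * h * g⁻¹ * h⁻¹) = _
    simp [coe_commutatorHom]
  have hmem : ∀ g h : G, g * h * g⁻¹ * h⁻¹ ∈ isolator G := fun g h =>
    commutator_le_isolator G
      (Subgroup.commutator_mem_commutator (Subgroup.mem_top g) (Subgroup.mem_top h))
  -- If all these values vanished, `l` would vanish on the image of I(G'), which contains the chosen
  -- commutator.
  refine ⟨fun k => (l (F (b' k))).toAdd, ?_, ?_⟩
  · intro h0
    obtain ⟨g, rfl⟩ := hf x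
    obtain ⟨h, rfl⟩ := hf y
    obtain ⟨q, hq, -⟩ := hbu _ (hmem g h)
    have h1 := hval ⟨_, hmem g h⟩ q hq
    rw [hcomm, hlz] at h1
    have h2 : ∀ k, (l (F (b' k))).toAdd = 0 := fun k => congrFun h0 k
    simp [h2] at h1
  -- `μ` kills the center and sends `f (a i)` to row `i` of the combined form.
  · let μ : H →* Multiplicative (Fin n → ℚ) :=
      { toFun := fun u => Multiplicative.ofAdd fun j => (l (commutatorHom hc (f (a j)) u)).toAdd
        map_one' := by
          simp only [map_one, toAdd_one]
          rfl
        map_mul' := fun u v => by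
          simp only [map_mul, toAdd_mul]
          rfl }
    have hlt := finrank_ratSpan_lt_of_hasPolycyclicRank μ l hH (fun u hu => by
      change Multiplicative.ofAdd (fun j => _) = _
      simp only [commutatorHom_eq_one_of_mem_center hc hu, map_one, toAdd_one]
      rfl) (z := commutatorHom hc y x) (fun h => by simp [h] at hlz)
    refine lt_of_le_of_lt ?_ hlt
    rw [Matrix.rank_eq_finrank_span_row]
    refine Submodule.finrank_mono (Submodule.span_le.2 ?_)
    rintro _ ⟨i, rfl⟩
    refine (congrArg (· ∈ ratSpan μ Set.univ) ?_).mpr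
      (toAdd_mem_ratSpan μ (Set.mem_univ (f (a i))))
    funext j
    change (∑ k : Fin t, (l (F (b' k))).toAdd * ((coeff (Φ k) i j : ℤ) : ℚ)) =
      (l (commutatorHom hc (f (a j)) (f (a i)))).toAdd
    rw [← hcomm _ _ (hmem _ _), hval _ _ (hab i j).symm]
    exact Finset.sum_congr rfl fun k _ => mul_comm _ _

/-! ### Parametrizing the degenerate tuples. -/

/-- The positions of the matrix entries above the diagonal. -/
abbrev UpperPair (n : ℕ) := {p : Fin n × Fin n // p.1 < p.2}

/-- More polynomials than variables satisfy a polynomial relation. -/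
theorem exists_ne_zero_aeval_eq_zero {K α β : Type*} [Field K] [Fintype α] [Fintype β]
    (h : Fintype.card α < Fintype.card β) (g : β → MvPolynomial α K) :
    ∃ F : MvPolynomial β K, F ≠ 0 ∧ MvPolynomial.aeval g F = 0 := by
  -- Otherwise `g` is algebraically independent, and its size is bounded by the transcendence
  -- degree, the number of variables.
  by_contra! hF
  have hg : AlgebraicIndependent K g := algebraicIndependent_iff.2 fun F hF' => by
    by_contra hne
    exact hF F hne hF'
  have := hg.lift_cardinalMk_le_trdeg
  rw [MvPolynomial.trdeg_of_isDomain] at this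
  simp only [Cardinal.mk_fintype, Cardinal.lift_natCast, Nat.cast_le] at this
  omega

/-- A skew-symmetric matrix is determined by a set of rows that span its row space and by the
coordinates of the other rows. -/
theorem exists_rows_of_skew {K : Type*} [Field K] {n : ℕ} (M : Matrix (Fin n) (Fin n) K)
    (hM : ∀ i j, M i j = -M j i) :
    ∃ (S : Finset (Fin n)) (p : Fin n → Fin n → K), S.card ≤ M.rank ∧
      (∀ i ∈ S, ∀ a, p i a = if i = a then 1 else 0) ∧
      ∀ i j, M i j = ∑ a ∈ S, ∑ b ∈ S, p i a * p j b * M a b := by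
  classical
  obtain ⟨κ, a, ha, hspan, hli⟩ := exists_linearIndependent' K M.row
  have : Fintype κ := Fintype.ofInjective a ha
  have hcard : (Finset.univ.image a).card = M.rank := by
    rw [Finset.card_image_of_injective _ ha, Matrix.rank_eq_finrank_span_row, ← hspan,
      finrank_span_eq_card hli, Finset.card_univ]
  have hex : ∀ i, ∃ c : Fin n → K,
      (i ∈ Finset.univ.image a → ∀ b, c b = if i = b then 1 else 0) ∧
      ∀ j, M i j = ∑ b ∈ Finset.univ.image a, c b * M b j := by
    intro i
    by_cases hi : i ∈ Finset.univ.image a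
    · exact ⟨fun b => if i = b then 1 else 0, fun _ _ => rfl, fun j => by simp [hi]⟩
    · have hmem : M.row i ∈ Submodule.span K (M.row '' (Finset.univ.image a : Finset (Fin n))) := by
        rw [Finset.coe_image, Finset.coe_univ, Set.image_univ, ← Set.range_comp, hspan]
        exact Submodule.subset_span ⟨i, rfl⟩
      obtain ⟨c, hc⟩ := (Submodule.mem_span_image_finset_iff_exists_fun K).1 hmem
      refine ⟨fun b => if h : b ∈ Finset.univ.image a then c ⟨b, h⟩ else 0,
        fun h => absurd h hi, fun j => ?_⟩
      rw [← Finset.sum_coe_sort, show M i j = M.row i j from rfl, ← hc, Finset.sum_apply]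
      refine Finset.sum_congr rfl fun b _ => ?_
      beta_reduce
      rw [dif_pos b.2]
      rfl
  choose p hp hp' using hex
  refine ⟨Finset.univ.image a, p, hcard.le, fun i hi b => hp i hi b, fun i j => ?_⟩
  rw [hp' i j]
  refine Finset.sum_congr rfl fun b _ => ?_
  -- Skew-symmetry turns columns into rows, so the same coordinates `p` expand the second index.
  rw [hM b j, hp' j b, ← Finset.sum_neg_distrib, Finset.mul_sum]
  refine Finset.sum_congr rfl fun d _ => ?_
  rw [hM d b]
  ring

/-- The pairs missing `S` are the pairs inside its complement. -/
theorem card_upperPair_meeting {n : ℕ} (S : Finset (Fin n)) :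
    Fintype.card {p : UpperPair n // p.1.1 ∈ S ∨ p.1.2 ∈ S} + (n - S.card).choose 2 =
      Fintype.card (UpperPair n) := by
  have h1 : (n - S.card).choose 2 =
      (Finset.univ.filter fun p : UpperPair n => ¬ (p.1.1 ∈ S ∨ p.1.2 ∈ S)).card := by
    rw [← Finset.card_map (Function.Embedding.subtype _),
      show n - S.card = Sᶜ.card by rw [Finset.card_compl, Fintype.card_fin],
      ← Finset.card_product_filter_lt]
    congr 1
    ext ⟨i, j⟩
    simp
  rw [h1, Fintype.card_subtype, Finset.card_filter_add_card_filter_not, Finset.card_univ]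

/-- The parameters of a tuple of forms in which a combination involving the `k`-th form has its
row space spanned by the rows in `S`. -/
abbrev Param {n t : ℕ} (S : Finset (Fin n)) (k : Fin t) :=
  {p : UpperPair n // p.1.1 ∈ S ∨ p.1.2 ∈ S} ⊕ ({l : Fin t // l ≠ k} ⊕
    {l : Fin t // l ≠ k} × UpperPair n)

/-- With s = |S| the count is C(n,2) - C(n-s,2) + (t-1) + (t-1)·C(n,2), and t - 1 < C(n-s,2). -/
theorem card_param_lt {n t r : ℕ} (h : t ≤ (n - r).choose 2) {S : Finset (Fin n)}
    (hS : S.card ≤ r) (k : Fin t) :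
    Fintype.card (Param S k) < Fintype.card (Fin t × UpperPair n) := by
  have h1 := card_upperPair_meeting S
  have h2 : (n - r).choose 2 ≤ (n - S.card).choose 2 := Nat.choose_le_choose 2 (by omega)
  have h3 : Fintype.card {l : Fin t // l ≠ k} = t - 1 := by simp
  have ht : 0 < t := k.pos
  simp only [Fintype.card_sum, Fintype.card_prod, Fintype.card_fin] at h3 ⊢
  rw [h3]
  obtain ⟨s, rfl⟩ : ∃ s, t = s + 1 := ⟨t - 1, by omega⟩
  rw [Nat.add_sub_cancel, add_mul]
  omega

section param

variable {n t : ℕ} (S : Finset (Fin n)) (k : Fin t)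

/-- The parameter at the entry `(i, j)`, or zero if there is none. -/
noncomputable def entryPoly (i j : Fin n) : MvPolynomial (Param S k) ℚ :=
  if h : i < j ∧ (i ∈ S ∨ j ∈ S) then MvPolynomial.X (Sum.inl ⟨⟨(i, j), h.1⟩, h.2⟩) else 0

/-- The coordinate of the `i`-th row at the `a`-th row, for `a ∈ S`. -/
noncomputable def rowPoly (i a : Fin n) : MvPolynomial (Param S k) ℚ :=
  if i ∈ S then if i = a then 1 else 0 else entryPoly S k i a + entryPoly S k a i

/-- The polynomial map parametrizing the degenerate tuples of forms. -/
noncomputable def degeneratePoly (q : Fin t × UpperPair n) : MvPolynomial (Param S k) ℚ :=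
  if h : q.1 = k then
    (∑ a ∈ S, ∑ b ∈ S, rowPoly S k q.2.1.1 a * rowPoly S k q.2.1.2 b *
      (entryPoly S k a b - entryPoly S k b a)) +
    ∑ l : {l : Fin t // l ≠ k}, MvPolynomial.X (Sum.inr (Sum.inl l)) *
      MvPolynomial.X (Sum.inr (Sum.inr (l, q.2)))
  else MvPolynomial.X (Sum.inr (Sum.inr (⟨q.1, h⟩, q.2)))

/-- The degenerate tuples are values of the parametrization. -/
theorem exists_eval_degeneratePoly {A : Fin t → Matrix (Fin n) (Fin n) ℚ} {c : Fin t → ℚ}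
    (hc : c k ≠ 0) {M : Matrix (Fin n) (Fin n) ℚ} (hMA : M = ∑ l, c l • A l)
    (hM : ∀ i j, M i j = -M j i) {p : Fin n → Fin n → ℚ}
    (hp : ∀ i ∈ S, ∀ a, p i a = if i = a then 1 else 0)
    (hMp : ∀ i j, M i j = ∑ a ∈ S, ∑ b ∈ S, p i a * p j b * M a b) :
    ∃ x : Param S k → ℚ, ∀ q : Fin t × UpperPair n,
      MvPolynomial.eval x (degeneratePoly S k q) = A q.1 q.2.1.1 q.2.1.2 := by
  -- A position inside `S` stores an entry of M / c_k; a position with one index in `S` stores the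
  -- coordinate of the outside row at the inside one. The remaining parameters solve Σ c_l A_l = M
  -- for A_k.
  let v : Fin n → Fin n → ℚ := fun i j =>
    if i ∈ S then if j ∈ S then (c k)⁻¹ * M i j else p j i else p i j
  let x : Param S k → ℚ := Sum.elim (fun q => v q.1.1.1 q.1.1.2)
    (Sum.elim (fun l => -((c k)⁻¹ * c l)) fun q => A q.1 q.2.1.1 q.2.1.2)
  have he : ∀ i j, MvPolynomial.eval x (entryPoly S k i j) =
      if i < j ∧ (i ∈ S ∨ j ∈ S) then v i j else 0 := by
    intro i j
    unfold entryPoly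
    split_ifs with h
    · rw [MvPolynomial.eval_X]
      rfl
    · simp
  have hform : ∀ a ∈ S, ∀ b ∈ S,
      MvPolynomial.eval x (entryPoly S k a b - entryPoly S k b a) = (c k)⁻¹ * M a b := by
    intro a ha b hb
    rw [map_sub, he, he]
    rcases lt_trichotomy a b with h | rfl | h
    · simp [h, h.not_gt, ha, hb, v]
    · have : M a a = 0 := by linarith [hM a a]
      simp [this]
    · simp [h, h.not_gt, ha, hb, v, hM a b]
  have hrow : ∀ i, ∀ a ∈ S, MvPolynomial.eval x (rowPoly S k i a) = p i a := by
    intro i a ha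
    unfold rowPoly
    by_cases hi : i ∈ S
    · rw [if_pos hi, hp i hi a]
      split_ifs <;> simp
    · rw [if_neg hi, map_add, he, he]
      -- Only one of the two orders lies above the diagonal, so one summand is zero.
      have hne : i ≠ a := fun h => hi (h ▸ ha)
      rcases lt_or_gt_of_ne hne with h | h
      · simp [h, h.not_gt, ha, hi, v]
      · simp [h, h.not_gt, ha, hi, v]
  refine ⟨x, fun ⟨l, q⟩ => ?_⟩
  unfold degeneratePoly
  by_cases h : l = k
  · subst h
    rw [dif_pos rfl, map_add, map_sum, map_sum]
    have h1 : ∑ a ∈ S, MvPolynomial.eval x (∑ b ∈ S, rowPoly S l q.1.1 a * rowPoly S l q.1.2 b *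
        (entryPoly S l a b - entryPoly S l b a)) = (c l)⁻¹ * M q.1.1 q.1.2 := by
      rw [hMp q.1.1 q.1.2, Finset.mul_sum]
      refine Finset.sum_congr rfl fun a ha => ?_
      rw [map_sum, Finset.mul_sum]
      refine Finset.sum_congr rfl fun b hb => ?_
      rw [map_mul, map_mul, hrow _ a ha, hrow _ b hb, hform a ha b hb]
      ring
    have h2 : M q.1.1 q.1.2 = c l * A l q.1.1 q.1.2 +
        ∑ j : {j : Fin t // j ≠ l}, c j * A j q.1.1 q.1.2 := by
      rw [hMA, Matrix.sum_apply, Fintype.sum_eq_add_sum_subtype_ne _ l]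
      simp
    have h3 : ∑ j : {j : Fin t // j ≠ l}, MvPolynomial.eval x
        (MvPolynomial.X (Sum.inr (Sum.inl j)) * MvPolynomial.X (Sum.inr (Sum.inr (j, q)))) =
        -((c l)⁻¹ * ∑ j : {j : Fin t // j ≠ l}, c j * A j q.1.1 q.1.2) := by
      rw [Finset.mul_sum, ← Finset.sum_neg_distrib]
      refine Finset.sum_congr rfl fun j _ => ?_
      rw [map_mul, MvPolynomial.eval_X, MvPolynomial.eval_X]
      simp only [x, Sum.elim_inr, Sum.elim_inl]
      ring
    rw [h1, h3, h2]
    field_simp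
    ring
  · rw [dif_neg h, MvPolynomial.eval_X]
    rfl

end param

/-- Some nonzero polynomial vanishes at the tuples of skew-symmetric matrices that have a
nontrivial combination of rank at most `r`. -/
theorem exists_polynomial_of_rank_le {n t r : ℕ} (h : t ≤ (n - r).choose 2) :
    ∃ F : MvPolynomial (Fin t × UpperPair n) ℚ, F ≠ 0 ∧
      ∀ A : Fin t → Matrix (Fin n) (Fin n) ℚ, (∀ l i j, A l i j = -A l j i) →
        ∀ c : Fin t → ℚ, c ≠ 0 → (∑ l, c l • A l).rank ≤ r →
          MvPolynomial.eval (fun q => A q.1 q.2.1.1 q.2.1.2) F = 0 := by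
  classical
  have hex : ∀ s : {S : Finset (Fin n) // S.card ≤ r} × Fin t,
      ∃ F : MvPolynomial (Fin t × UpperPair n) ℚ, F ≠ 0 ∧
        MvPolynomial.aeval (degeneratePoly s.1.1 s.2) F = 0 := fun s =>
    exists_ne_zero_aeval_eq_zero (card_param_lt h s.1.2 s.2) _
  choose F hF0 hF using hex
  -- The product covers every choice of spanning rows `S` and of an index `k` with `c k ≠ 0`.
  refine ⟨∏ s, F s, Finset.prod_ne_zero_iff.2 fun s _ => hF0 s, fun A hA c hc hr => ?_⟩
  obtain ⟨k, hk⟩ := Function.ne_iff.1 hc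
  have hskew : ∀ i j, (∑ l, c l • A l) i j = -(∑ l, c l • A l) j i := fun i j => by
    rw [Matrix.sum_apply, Matrix.sum_apply, ← Finset.sum_neg_distrib]
    refine Finset.sum_congr rfl fun l _ => ?_
    rw [Matrix.smul_apply, Matrix.smul_apply, hA l i j, smul_neg]
  obtain ⟨S, p, hS, hp, hMp⟩ := exists_rows_of_skew _ hskew
  obtain ⟨x, hx⟩ := exists_eval_degeneratePoly S k hk rfl hskew hp hMp
  rw [map_prod]
  refine Finset.prod_eq_zero (Finset.mem_univ (⟨S, hS.trans hr⟩, k)) ?_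
  have h1 := congrArg (MvPolynomial.eval x) (hF (⟨S, hS.trans hr⟩, k))
  rw [map_zero] at h1
  rw [← h1, MvPolynomial.aeval_def, ← MvPolynomial.coe_eval₂Hom]
  change _ = ((MvPolynomial.eval x).comp (MvPolynomial.eval₂Hom _ _)) _
  rw [MvPolynomial.comp_eval₂Hom]
  simp only [hx]
  congr 1
  ext q <;> simp

theorem coeff_skew {R : Type*} [CommRing R] {n : ℕ} (φ : AltForms R n) (i j : Fin n) :
    coeff φ i j = -coeff φ j i :=
  (φ.2.neg_eq _ _).symm

theorem coeff_toRat {n : ℕ} (φ : AltForms ℤ n) (i j : Fin n) :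
    coeff (toRat φ) i j = ((coeff φ i j : ℤ) : ℚ) := by
  simp [coeff, toRat]

/-- There is an alternating form with given matrix entries above the diagonal. -/
theorem exists_altForms_coeff {n : ℕ} (y : UpperPair n → ℚ) :
    ∃ φ : AltForms ℚ n, ∀ q : UpperPair n, coeff φ q.1.1 q.1.2 = y q := by
  let B : Matrix (Fin n) (Fin n) ℚ := Matrix.of fun i j => if h : i < j then y ⟨(i, j), h⟩ else 0
  refine ⟨⟨Matrix.toBilin' (B - B.transpose), fun v => ?_⟩, fun q => ?_⟩
  · rw [map_sub, LinearMap.sub_apply, LinearMap.sub_apply, Matrix.toBilin'_apply',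
      Matrix.toBilin'_apply', Matrix.mulVec_transpose, dotProduct_comm v (Matrix.vecMul v B),
      Matrix.dotProduct_mulVec, sub_self]
  · simp [coeff, B, q.2, q.2.not_gt]

end GenericNilpotent

/-! ### The genericity statement. -/

theorem mainTheorem9 (n t N : ℕ) (hN : N < n)
    (ht : (t : ℚ) < (n : ℚ) ^ 2 / 2 - n * ((N : ℚ) - 1 / 2) + (N : ℚ) * ((N : ℚ) - 1) / 2 + 1) :
    GenericNilpotent.Generically n t fun (G : Type*) [Group G] =>
      ¬ ∃ (H : Type*) (_ : Group H),
        GenericNilpotent.TorsionFree H ∧ (∃ x y : H, x * y ≠ y * x) ∧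
        GenericNilpotent.HasPolycyclicRank H N ∧
        ∃ f : G →* H, Function.Surjective f := by
  open GenericNilpotent in
  -- For N = 0 no rank is less than `N`, so the empty closed set serves; otherwise r = N - 1 is a
  -- true subtraction.
  rcases Nat.eq_zero_or_pos N with rfl | hN0
  · refine ⟨∅, ⟨{1}, by simp⟩, Set.empty_ne_univ, ?_⟩
    rintro Φ - ⟨G, _, hG, hΦ, hA⟩
    obtain ⟨H, _, htf, hna, hH, f, hf⟩ := not_not.1 hA
    obtain ⟨c, -, hc⟩ := exists_rank_lt_of_surjective hG.two_step hΦ htf hna hH hf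
    exact absurd hc (Nat.not_lt_zero _)
  have ht' : t ≤ (n - (N - 1)).choose 2 := by
    -- With n = N + d the bound in `ht` equals C(d+1,2) + 1.
    obtain ⟨d, rfl⟩ : ∃ d, n = N + d := ⟨n - N, by omega⟩
    rw [show N + d - (N - 1) = d + 1 by omega]
    have h1 : (((d + 1).choose 2 : ℕ) : ℚ) = (d + 1) * d / 2 := by
      rw [Nat.cast_choose_two]
      push_cast
      ring
    have h2 : (t : ℚ) < (((d + 1).choose 2 + 1 : ℕ) : ℚ) := by
      push_cast [h1] at ht ⊢
      linarith
    exact Nat.lt_succ_iff.1 (Nat.cast_lt.1 h2)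
  obtain ⟨F, hF0, hF⟩ := exists_polynomial_of_rank_le ht'
  let ι : Fin t × UpperPair n → Fin t × Fin n × Fin n := fun q => (q.1, q.2.1)
  refine ⟨_, ⟨{MvPolynomial.rename ι F}, rfl⟩, ?_, ?_⟩
  -- Properness: `F ≠ 0` is nonzero at some rational point, and the entries above the diagonal of
  -- alternating forms are arbitrary.
  · obtain ⟨y, hy⟩ : ∃ y, MvPolynomial.eval y F ≠ 0 := by
      by_contra! h
      exact hF0 (MvPolynomial.funext fun y => by rw [h y, map_zero])
    choose φ hφ using fun l => exists_altForms_coeff fun q => y (l, q)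
    intro h
    have hmem := Set.eq_univ_iff_forall.1 h φ (MvPolynomial.rename ι F) rfl
    rw [MvPolynomial.eval_rename] at hmem
    refine hy ?_
    rw [← hmem]
    congr 2
    funext q
    exact (hφ q.1 q.2).symm
  · rintro Φ - ⟨G, _, hG, hΦ, hA⟩ _ rfl
    obtain ⟨H, _, htf, hna, hH, f, hf⟩ := not_not.1 hA
    obtain ⟨c, hc0, hc⟩ := exists_rank_lt_of_surjective hG.two_step hΦ htf hna hH hf
    rw [MvPolynomial.eval_rename]
    refine hF (fun l => Matrix.of fun i j => coeff (toRat (Φ l)) i j)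
      (fun l i j => coeff_skew (toRat (Φ l)) i j) c hc0 (Nat.le_sub_one_of_lt ?_)
    convert hc using 2
    ext i j
    simp [Matrix.sum_apply, coeff_toRat]
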